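/- Let $\xi(s)=\tfrac12 s(s-1)\pi^{-s/2}\Gamma(s/2)\zeta(s)$ (extended to an entire function), and for $n\ge 0$ let $$c_n=2\,n!\,(-1)^n a_{2n},\qquad a_{2n}=\frac{\xi^{(2n)}(1/2)}{(2n)!}.$$ Assume the Riemann Hypothesis. Then the following hold. (0) For every complex $x$, $\;2\xi(\tfrac12+ix)=\sum_{n=0}^\infty c_n\,x^{2n}/n!$. (1) $\displaystyle c_0=-\frac{\Gamma(1/4)\,\zeta(1/2)}{4\pi^{1/4}}$. (2) The zeros of $\zeta$ with $0<\operatorname{Re}s<1$ and positive imaginary part, repeated according to multiplicity, can be listed as an infinite sequence $s_1,s_2,\dots$. Moreover, for every such listing, with $t_r=\operatorname{Im}s_r$ (so that $s_r=\tfrac12+it_r$ and the nontrivial zeros are $\tfrac12\pm it_r$), all sums and products below converge unconditionally and: (3) for every complex $x$, $\displaystyle\;2\xi(\tfrac12+ix)=c_0\prod_{r=1}^\infty\Bigl(1-\frac{x^2}{t_r^2}\Bigr)$; (4) $\displaystyle c_1=-c_0\sum_{r\ge1}\frac1{t_r^2},\qquad c_2=2!\,c_0\sum_{i<j}\frac1{t_i^2t_j^2},\qquad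 c_3=-3!\,c_0\sum_{i<j<m}\frac1{t_i^2t_j^2t_m^2}$; (5) for every $l\ge0$, $\displaystyle\; c_l=(-1)^l\,l!\,c_0\sum_{i_1<\dots<i_l}\frac1{t_{i_1}^2\cdots t_{i_l}^2}$ (the sum being $1$ for $l=0$); (6) $\displaystyle\;\frac{d^2}{dx^2}\,\xi(\tfrac12+ix)\Big|_{x=0}=c_1=-c_0\sum_{r\ge1}\frac1{t_r^2}$, that is, $\displaystyle\;\xi''(\tfrac12)=-c_1=c_0\sum_{r\ge1}\frac1{t_r^2}$. -/

import Mathlib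

noncomputable section

/-- The Riemann xi function, the entire function with
`ξ(s) = ½ s (s - 1) π^(-s/2) Γ(s/2) ζ(s)`. It is written through the entire part `Λ₀` of
`Λ(s) = π^(-s/2) Γ(s/2) ζ(s) = Λ₀(s) - 1/s - 1/(1-s)`, so that it also has the right values at
`s = 0, 1` and at the poles of `Γ(s/2)`; see `riemannXi_eq` for the product formula. -/
def riemannXi (s : ℂ) : ℂ := (1 + s * (s - 1) * completedRiemannZeta₀ s) / 2

theorem riemannXi_eq {s : ℂ} (hs : 0 < s.re) (hs1 : s ≠ 1) :
    riemannXi s =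
      1 / 2 * s * (s - 1) * (Real.pi : ℂ) ^ (-s / 2) * Complex.Gamma (s / 2) * riemannZeta s := by
  have h0 : s ≠ 0 := by
    rintro rfl
    simp at hs
  have hG := Complex.Gammaℝ_ne_zero_of_re_pos hs
  have hz := riemannZeta_def_of_ne_zero h0
  have h1 : (1 - s) ≠ 0 := sub_ne_zero.mpr (Ne.symm hs1)
  have h2 : (Real.pi : ℂ) ^ (-s / 2) * Complex.Gamma (s / 2) * riemannZeta s =
      completedRiemannZeta₀ s - 1 / s - 1 / (1 - s) := by
    rw [← completedRiemannZeta_eq, hz, ← Complex.Gammaℝ_def]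
    field_simp
  have h3 : 1 / 2 * s * (s - 1) * (Real.pi : ℂ) ^ (-s / 2) * Complex.Gamma (s / 2) *
      riemannZeta s = 1 / 2 * s * (s - 1) *
      ((Real.pi : ℂ) ^ (-s / 2) * Complex.Gamma (s / 2) * riemannZeta s) := by ring
  rw [h3, h2, riemannXi]
  field_simp
  ring

/-- The Taylor coefficients `a_{2n}` of `ξ(s) = ∑ a_{2n} (s - ½)^{2n}`. -/
def xiTaylorCoeff (n : ℕ) : ℂ := iteratedDeriv (2 * n) riemannXi (1 / 2) / (2 * n).factorial

/-- The coefficients `c_n` of `2 ξ(½ + i x) = ∑ c_n x^{2n} / n!`, that is,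
`c_n = 2 (n!) (-1)^n a_{2n}`. -/
def jensenCoeff (n : ℕ) : ℂ := 2 * (n.factorial : ℂ) * (-1) ^ n * xiTaylorCoeff n

/-- `s 0, s 1, s 2, …` is a list of all the nontrivial zeros `ρ` of `ζ` (those with
`0 < Re ρ < 1`) that have positive imaginary part, each repeated according to its multiplicity. -/
structure EnumeratesUpperZeros (s : ℕ → ℂ) : Prop where
  re_pos : ∀ r, 0 < (s r).re
  re_lt_one : ∀ r, (s r).re < 1
  im_pos : ∀ r, 0 < (s r).im
  encard_eq : ∀ ρ : ℂ, 0 < ρ.re → ρ.re < 1 → 0 < ρ.im →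
    {r : ℕ | s r = ρ}.encard = analyticOrderAt riemannZeta ρ

end

/-! The functional equation makes `ξ(½ + i x)` even, so it is `G(x²)/2` for an entire `G`
(`xiSquare`). Since `ξ(½ + i x)` grows more slowly than `exp(ε|x|²)` for every `ε > 0`, `G` has
minimal exponential type. Under RH its zeros, with multiplicity, are exactly the numbers `t_r² > 0`.

Such a function is its canonical product of genus zero (`summable_and_eq_tprod_of_zeros_pos`).
Divide out the zeros in `|z| ≤ R`: the quotient has a logarithm on `|z| < R`, and Borel–Carathéodory
shows that this logarithm, normalised at `0`, tends to `0` at each fixed point. So the partial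
products by modulus converge to `G/G(0)`. At `w = -1` they bound `∑ 1/t_r²`, because the zeros are
positive, and convergence becomes absolute. Expanding the product over finite index sets and
comparing power series gives every `c_l`.

The growth bound comes from positivity: `Λ₀` is the Mellin transform of a nonnegative kernel, so
`|Λ₀(s)| ≤ Λ₀(Re s)`, which increases with the distance of `Re s` from `½` and is at most `n!` at
`2n + 2`. The lower bound on `ξ(2n + 2)` excludes a finite set of zeros. -/

/-! ### Canonical products of entire functions of minimal exponential type -/

theorem analyticOrderAt_prod_one_sub_div {ι : Type*} {z : ι → ℂ} (hz : ∀ i, z i ≠ 0)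
    (T : Finset ι) (w : ℂ) :
    analyticOrderAt (fun w : ℂ => ∏ i ∈ T, (1 - w / z i)) w =
      {i | i ∈ T ∧ z i = w}.encard := by
  classical
  induction T using Finset.induction_on with
  | empty =>
    simp only [Finset.prod_empty, Finset.notMem_empty, false_and, Set.ofPred_false,
      Set.encard_empty]
    exact analyticAt_const.analyticOrderAt_eq_zero.mpr one_ne_zero
  | insert j T hj ih =>
    have hd : Differentiable ℂ (fun w : ℂ => 1 - w / z j) := by fun_prop
    have hPd : Differentiable ℂ (fun w : ℂ => ∏ i ∈ T, (1 - w / z i)) := by fun_prop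
    have h1 : (fun w : ℂ => ∏ i ∈ insert j T, (1 - w / z i)) =
        (fun w : ℂ => 1 - w / z j) * (fun w : ℂ => ∏ i ∈ T, (1 - w / z i)) := by
      ext w
      simp [Finset.prod_insert hj]
    rw [h1, analyticOrderAt_mul (hd.analyticAt _) (hPd.analyticAt _), ih]
    by_cases hjw : z j = w
    · have h2 : {i | i ∈ insert j T ∧ z i = w} = insert j {i | i ∈ T ∧ z i = w} := by
        ext i
        simp only [Finset.mem_insert, Set.mem_ofPred_eq, Set.mem_insert_iff]
        grind
      rw [h2, Set.encard_insert_of_notMem (by simp [hj]), add_comm]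
      congr 1
      refine (hd.analyticAt _).analyticOrderAt_eq_one_of_zero_deriv_ne_zero ?_ ?_
      · simp [← hjw, hz j]
      · simp [hz j]
    · have h2 : {i | i ∈ insert j T ∧ z i = w} = {i | i ∈ T ∧ z i = w} := by
        ext i
        simp only [Finset.mem_insert, Set.mem_ofPred_eq]
        grind
      rw [h2, (hd.analyticAt _).analyticOrderAt_eq_zero.mpr, zero_add]
      rw [sub_ne_zero, ne_comm, Ne, div_eq_one_iff_eq (hz j)]
      exact fun h => hjw h.symm

theorem exists_eq_prod_one_sub_div_mul {ι : Type*} {G : ℂ → ℂ} (hG : Differentiable ℂ G)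
    (hG0 : G 0 ≠ 0) {z : ι → ℂ}
    (hz : ∀ w, {i | z i = w}.encard = analyticOrderAt G w) (T : Finset ι) :
    ∃ g : ℂ → ℂ, Differentiable ℂ g ∧ ∀ w, G w = (∏ i ∈ T, (1 - w / z i)) * g w := by
  classical
  have hz0 : ∀ i, z i ≠ 0 := by
    intro i hi
    have h1 : analyticOrderAt G 0 = 0 := (hG.analyticAt 0).analyticOrderAt_eq_zero.mpr hG0
    rw [← hz 0, Set.encard_eq_zero] at h1
    exact (Set.eq_empty_iff_forall_notMem.mp h1 i) hi
  induction T using Finset.induction_on with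
  | empty => exact ⟨G, hG, by simp⟩
  | insert j T hj ih =>
    obtain ⟨g, hg, hGg⟩ := ih
    have hfun : G = (fun w => ∏ i ∈ T, (1 - w / z i)) * g := funext hGg
    have hPd : Differentiable ℂ (fun w : ℂ => ∏ i ∈ T, (1 - w / z i)) := by fun_prop
    have hgz : g (z j) = 0 := by
      by_contra hne
      have hg1 : analyticOrderAt g (z j) = 0 := (hg.analyticAt _).analyticOrderAt_eq_zero.mpr hne
      have h1 : analyticOrderAt G (z j) =
          analyticOrderAt (fun w : ℂ => ∏ i ∈ T, (1 - w / z i)) (z j) := by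
        conv_lhs => rw [hfun]
        rw [analyticOrderAt_mul (hPd.analyticAt _) (hg.analyticAt _), hg1, add_zero]
      have h2 := analyticOrderAt_prod_one_sub_div hz0 T (z j)
      rw [← hz, h2] at h1
      -- If `g` did not vanish at `z j`, the indices in `T` would already account for the full order
      -- of `G` there, leaving no room for `j`.
      have h3 : insert j {i | i ∈ T ∧ z i = z j} ⊆ {i | z i = z j} := by
        rintro i (rfl | hi)
        · rfl
        · exact hi.2
      have h4 := Set.encard_le_encard h3
      rw [Set.encard_insert_of_notMem (by simp [hj]), h1] at h4
      have hfin : {i | i ∈ T ∧ z i = z j}.Finite := T.finite_toSet.subset fun i hi => hi.1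
      have := (ENat.add_one_le_iff (Set.encard_ne_top_iff.mpr hfin)).mp h4
      exact lt_irrefl _ this
    refine ⟨fun w => -z j * dslope g (z j) w, ?_, fun w => ?_⟩
    · have : DifferentiableOn ℂ (dslope g (z j)) Set.univ :=
        (Complex.differentiableOn_dslope Filter.univ_mem).mpr hg.differentiableOn
      exact (differentiableOn_univ.mp this).const_mul _
    · have h1 : (w - z j) * dslope g (z j) w = g w := by
        have := sub_smul_dslope g (z j) w
        simpa [hgz] using this
      rw [hGg, Finset.prod_insert hj, ← h1]
      have := hz0 j
      field_simp
      ring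

/-- The zeros of `G` are isolated, so a disc contains finitely many of them, each of finite order.
-/
theorem finite_norm_le_of_encard_eq_analyticOrderAt {ι : Type*} {G : ℂ → ℂ}
    (hG : Differentiable ℂ G) (hG0 : G 0 ≠ 0) {z : ι → ℂ}
    (hz : ∀ w, {i | z i = w}.encard = analyticOrderAt G w) (R : ℝ) :
    {i | ‖z i‖ ≤ R}.Finite := by
  have han : AnalyticOnNhd ℂ G Set.univ := fun w _ => hG.analyticAt w
  have hK : IsCompact (Metric.closedBall (0 : ℂ) R) := isCompact_closedBall _ _
  have hcod : G ⁻¹' {0}ᶜ ∈ Filter.codiscreteWithin (Metric.closedBall (0 : ℂ) R) :=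
    Filter.codiscreteWithin_mono (Set.subset_univ _) (han.preimage_zero_mem_codiscrete hG0)
  have hfin := hK.finite_sdiff_of_mem_codiscreteWithin hcod
  have hne : ∀ w, analyticOrderAt G w ≠ ⊤ := by
    intro w h
    rw [AnalyticOnNhd.analyticOrderAt_eq_top_iff_eq_zero w fun w => hG.analyticAt w] at h
    exact hG0 (congrFun h 0)
  refine Set.Finite.subset (Set.Finite.biUnion hfin fun w _ => ?_ :
    (⋃ w ∈ Metric.closedBall (0 : ℂ) R \ G ⁻¹' {0}ᶜ, {i | z i = w}).Finite) ?_
  · rw [← Set.encard_ne_top_iff, hz]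
    exact hne w
  · intro i hi
    have h0 : G (z i) = 0 := by
      apply apply_eq_zero_of_analyticOrderAt_ne_zero
      rw [← hz, Set.encard_ne_zero]
      exact ⟨i, rfl⟩
    simp only [Set.mem_iUnion, Set.mem_sdiff, mem_closedBall_zero_iff, Set.mem_preimage,
      Set.mem_compl_iff, Set.mem_singleton_iff, not_not]
    exact ⟨z i, ⟨hi, h0⟩, rfl⟩

/-- Take for `k` the primitive of `g'/g` on the disc; then `g exp(-k)` has derivative zero. -/
theorem exists_eq_mul_exp_of_ne_zero_on_ball {g : ℂ → ℂ} {R : ℝ}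
    (hg : Differentiable ℂ g) (hne : ∀ w ∈ Metric.ball (0 : ℂ) R, g w ≠ 0) (hR : 0 < R) :
    ∃ k : ℂ → ℂ, k 0 = 0 ∧ DifferentiableOn ℂ k (Metric.ball 0 R) ∧
      ∀ w ∈ Metric.ball (0 : ℂ) R, g w = g 0 * Complex.exp (k w) := by
  have hd : DifferentiableOn ℂ (fun w => deriv g w / g w) (Metric.ball 0 R) :=
    hg.deriv.differentiableOn.div hg.differentiableOn hne
  obtain ⟨k, hk0, hk⟩ := hd.isExactOn_ball.with_val_at 0 0
  refine ⟨k, hk0, fun w hw => (hk w hw).differentiableAt.differentiableWithinAt, fun w hw => ?_⟩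
  have h0 : (0 : ℂ) ∈ Metric.ball (0 : ℂ) R := Metric.mem_ball_self hR
  have hder : ∀ u ∈ Metric.ball (0 : ℂ) R,
      HasDerivAt (fun u => g u * Complex.exp (-k u)) 0 u := by
    intro u hu
    have h1 := (hg u).hasDerivAt.mul ((hk u hu).neg.cexp)
    refine h1.congr_deriv ?_
    have := hne u hu
    simp only [Pi.neg_apply]
    field_simp
    ring
  have hconst := (convex_ball (0 : ℂ) R).is_const_of_fderivWithin_eq_zero (𝕜 := ℂ)
    (f := fun u => g u * Complex.exp (-k u))
    (fun u hu => (hder u hu).differentiableAt.differentiableWithinAt)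
    (fun u hu => by
      rw [fderivWithin_of_isOpen Metric.isOpen_ball hu]
      ext
      simp [(hder u hu).deriv]) hw h0
  simp only [hk0, neg_zero, Complex.exp_zero, mul_one] at hconst
  rw [← hconst, mul_assoc, ← Complex.exp_add, neg_add_cancel, Complex.exp_zero, mul_one]

/-- The core of the Hadamard argument: after the zeros of modulus at most `R` are removed, what
remains at `w` is nearly the constant `G 0`. -/
theorem eventually_eq_prod_mul_exp {ι : Type*} {G : ℂ → ℂ}
    (hG : Differentiable ℂ G) (hG0 : G 0 ≠ 0) {z : ι → ℂ}
    (hz : ∀ w, {i | z i = w}.encard = analyticOrderAt G w)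
    (hgrowth : ∀ ε > 0, ∃ C : ℝ, ∀ w, ‖G w‖ ≤ C * Real.exp (ε * ‖w‖)) (w : ℂ) {δ : ℝ}
    (hδ : 0 < δ) :
    ∀ᶠ R : ℝ in Filter.atTop, ∀ T : Finset ι, (∀ i, i ∈ T ↔ ‖z i‖ ≤ R) →
      ∃ k : ℂ, ‖k‖ ≤ δ ∧ G w = (∏ i ∈ T, (1 - w / z i)) * (G 0 * Complex.exp k) := by
  -- Borel–Carathéodory will give `|k w| ≤ 2(A + 2εR)|w| / (R - |w|)`. This `ε` makes `4εR|w| ≤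
  -- δR/2`, and the lower bound on `R` below absorbs `2A|w| + δ|w|` into the other `δR/2`.
  have hε : 0 < δ / (8 * (‖w‖ + 1)) := by positivity
  set ε := δ / (8 * (‖w‖ + 1)) with hεdef
  obtain ⟨C, hC⟩ := hgrowth ε hε
  have hG0' : 0 < ‖G 0‖ := norm_pos_iff.mpr hG0
  have hCpos : 0 < C := by
    have := hC 0
    simp only [norm_zero, mul_zero, Real.exp_zero, mul_one] at this
    exact hG0'.trans_le this
  set A := |Real.log (C / ‖G 0‖)| with hA
  have hA0 : 0 ≤ A := abs_nonneg _
  filter_upwards [Filter.eventually_ge_atTop ((4 * ‖w‖ * A + 2 * δ * ‖w‖) / δ),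
    Filter.eventually_gt_atTop (‖w‖ + 1)] with R hR1 hR2 T hT
  have hRw : ‖w‖ < R := by linarith
  have hR : 0 < R := (norm_nonneg w).trans_lt hRw
  obtain ⟨g, hg, hGg⟩ := exists_eq_prod_one_sub_div_mul hG hG0 hz T
  have hz0 : ∀ i, z i ≠ 0 := by
    intro i hi
    have h1 : analyticOrderAt G 0 = 0 := (hG.analyticAt 0).analyticOrderAt_eq_zero.mpr hG0
    rw [← hz 0, Set.encard_eq_zero] at h1
    exact (Set.eq_empty_iff_forall_notMem.mp h1 i) hi
  have hg0 : g 0 = G 0 := by simpa using (hGg 0).symm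
  have hPd : Differentiable ℂ (fun w : ℂ => ∏ i ∈ T, (1 - w / z i)) := by fun_prop
  have hgne : ∀ u ∈ Metric.ball (0 : ℂ) R, g u ≠ 0 := by
    intro u hu
    have hfun : G = (fun w => ∏ i ∈ T, (1 - w / z i)) * g := funext hGg
    have h1 : analyticOrderAt G u = {i | z i = u}.encard + analyticOrderAt g u := by
      conv_lhs => rw [hfun]
      rw [analyticOrderAt_mul (hPd.analyticAt _) (hg.analyticAt _),
        analyticOrderAt_prod_one_sub_div hz0]
      congr 2
      ext i
      simp only [Set.mem_ofPred_eq, hT, and_iff_right_iff_imp]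
      rintro rfl
      exact (mem_ball_zero_iff.mp hu).le
    have hfin : {i | z i = u}.encard ≠ ⊤ := by
      rw [Set.encard_ne_top_iff]
      refine T.finite_toSet.subset fun i hi => ?_
      rw [Finset.mem_coe, hT, show z i = u from hi]
      exact (mem_ball_zero_iff.mp hu).le
    rw [hz] at h1 hfin
    have h2 : analyticOrderAt g u = 0 := by
      have : analyticOrderAt G u + 0 = analyticOrderAt G u + analyticOrderAt g u := by
        rw [add_zero]; exact h1
      exact (ENat.add_right_injective_of_ne_top hfin this).symm
    exact (hg.analyticAt u).analyticOrderAt_eq_zero.mp h2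
  have hgbound : ∀ u ∈ Metric.ball (0 : ℂ) R, ‖g u‖ ≤ C * Real.exp (ε * (2 * R)) := by
    intro u hu
    have hR2pos : (2 * R) ≠ 0 := by positivity
    refine Complex.norm_le_of_forall_mem_frontier_norm_le (U := Metric.ball (0 : ℂ) (2 * R))
      Metric.isBounded_ball hg.diffContOnCl (fun v hv => ?_) (subset_closure ?_)
    · rw [frontier_ball _ hR2pos, mem_sphere_zero_iff_norm] at hv
      -- On the circle of radius `2R` each `|v / z i|` is at least `2`, so dividing by the product
      -- cannot enlarge `G`; the maximum principle carries the bound inside.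
      have h1 : 1 ≤ ‖∏ i ∈ T, (1 - v / z i)‖ := by
        rw [norm_prod]
        refine Finset.one_le_prod fun i hi => ?_
        have hzi : 0 < ‖z i‖ := norm_pos_iff.mpr (hz0 i)
        have h3 : 2 ≤ ‖v / z i‖ := by
          rw [norm_div, hv, le_div_iff₀ hzi]
          linarith [(hT i).mp hi]
        have h4 := norm_sub_norm_le (v / z i) 1
        rw [norm_one, norm_sub_rev] at h4
        linarith
      have h2 := hC v
      rw [hGg, norm_mul, hv] at h2
      exact (le_mul_of_one_le_left (norm_nonneg _) h1).trans h2
    · rw [mem_ball_zero_iff] at hu ⊢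
      linarith
  obtain ⟨k, hk0, hkd, hk⟩ := exists_eq_mul_exp_of_ne_zero_on_ball hg hgne hR
  have hM : 0 < A + ε * (2 * R) := by positivity
  have hmaps : Set.MapsTo k (Metric.ball 0 R) {z | z.re ≤ A + ε * (2 * R)} := by
    intro u hu
    have h1 := hgbound u hu
    rw [hk u hu, norm_mul, Complex.norm_exp, hg0] at h1
    have h2 : Real.exp (k u).re ≤ C / ‖G 0‖ * Real.exp (ε * (2 * R)) := by
      rw [div_mul_eq_mul_div, le_div_iff₀ hG0', mul_comm]
      exact h1
    have h3 : C / ‖G 0‖ ≤ Real.exp A := by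
      rw [← Real.log_le_iff_le_exp (by positivity)]
      exact le_abs_self _
    have h4 : Real.exp (k u).re ≤ Real.exp (A + ε * (2 * R)) := by
      rw [Real.exp_add]
      exact h2.trans (by gcongr)
    exact Real.exp_le_exp.mp h4
  have hwball : w ∈ Metric.ball (0 : ℂ) R := mem_ball_zero_iff.mpr hRw
  refine ⟨k w, ?_, by rw [hGg, hk w hwball, hg0]⟩
  refine (Complex.borelCaratheodory_zero hM hkd hmaps hR hwball hk0).trans ?_
  rw [div_le_iff₀ (by linarith)]
  rw [div_le_iff₀ hδ] at hR1
  have h5 : 8 * ε * ‖w‖ ≤ δ := by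
    have : 8 * ε * (‖w‖ + 1) = δ := by rw [hεdef]; field_simp
    nlinarith
  nlinarith

theorem tendsto_prod_one_sub_div {ι : Type*} {G : ℂ → ℂ}
    (hG : Differentiable ℂ G) (hG0 : G 0 ≠ 0) {z : ι → ℂ}
    (hz : ∀ w, {i | z i = w}.encard = analyticOrderAt G w)
    (hgrowth : ∀ ε > 0, ∃ C : ℝ, ∀ w, ‖G w‖ ≤ C * Real.exp (ε * ‖w‖))
    {T : ℝ → Finset ι} (hT : ∀ R i, i ∈ T R ↔ ‖z i‖ ≤ R) (w : ℂ) :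
    Filter.Tendsto (fun R => ∏ i ∈ T R, (1 - w / z i)) Filter.atTop (nhds (G w / G 0)) := by
  have hcont : Filter.Tendsto (fun k : ℂ => G w / G 0 * Complex.exp (-k)) (nhds 0)
      (nhds (G w / G 0)) := by
    have : Continuous (fun k : ℂ => G w / G 0 * Complex.exp (-k)) := by fun_prop
    simpa using this.tendsto 0
  rw [Metric.tendsto_nhds]
  intro η hη
  obtain ⟨δ, hδ, hδη⟩ := Metric.tendsto_nhds_nhds.mp hcont η hη
  filter_upwards [eventually_eq_prod_mul_exp hG hG0 hz hgrowth w (half_pos hδ)] with R hR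
  obtain ⟨k, hk, hGk⟩ := hR (T R) (hT R)
  have h1 : ∏ i ∈ T R, (1 - w / z i) = G w / G 0 * Complex.exp (-k) := by
    rw [hGk, Complex.exp_neg]
    have := Complex.exp_ne_zero k
    field_simp
  rw [h1]
  apply hδη
  rw [dist_zero_right]
  linarith

theorem one_add_sum_le_prod_one_add {ι : Type*} {a : ι → ℝ} (T : Finset ι)
    (ha : ∀ i, 0 ≤ a i) : 1 + ∑ i ∈ T, a i ≤ ∏ i ∈ T, (1 + a i) := by
  classical
  induction T using Finset.induction_on with
  | empty => simp
  | insert j T hj ih =>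
    rw [Finset.prod_insert hj, Finset.sum_insert hj]
    have h1 : 0 ≤ ∑ i ∈ T, a i := Finset.sum_nonneg fun i _ => ha i
    have h2 := ha j
    nlinarith

/-- An entire function of minimal exponential type all of whose zeros are positive is the canonical
product over its zeros, and the sum of the reciprocals of the zeros converges. -/
theorem summable_and_eq_tprod_of_zeros_pos {ι : Type*} {G : ℂ → ℂ}
    (hG : Differentiable ℂ G) (hG0 : G 0 ≠ 0) {x : ι → ℝ} (hx : ∀ i, 0 < x i)
    (hz : ∀ w, {i | (x i : ℂ) = w}.encard = analyticOrderAt G w)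
    (hgrowth : ∀ ε > 0, ∃ C : ℝ, ∀ w, ‖G w‖ ≤ C * Real.exp (ε * ‖w‖)) :
    Summable (fun i => 1 / x i) ∧ ∀ w, G w = G 0 * ∏' i, (1 - w / (x i : ℂ)) := by
  classical
  have hfin := finite_norm_le_of_encard_eq_analyticOrderAt hG hG0 hz
  let T : ℝ → Finset ι := fun R => (hfin R).toFinset
  have hT : ∀ R i, i ∈ T R ↔ ‖(x i : ℂ)‖ ≤ R := fun R i => by simp [T]
  have hTtop : Filter.Tendsto T Filter.atTop Filter.atTop := by
    rw [Filter.tendsto_atTop]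
    intro S
    obtain ⟨B, hB⟩ := (S.image fun i => ‖(x i : ℂ)‖).bddAbove
    filter_upwards [Filter.eventually_ge_atTop B] with R hR i hi
    rw [hT]
    exact (hB (Finset.mem_coe.mpr (Finset.mem_image_of_mem _ hi))).trans hR
  have hlim := tendsto_prod_one_sub_div hG hG0 hz hgrowth hT
  have hsum : Summable (fun i => 1 / x i) := by
    -- At `-1` the factors are `1 + 1/x i ≥ 1`, so bounded products bound the sums of `1/x i`.
    have h1 := (hlim (-1)).norm
    obtain ⟨B, hB⟩ : ∃ B, B = ‖G (-1) / G 0‖ + 1 := ⟨_, rfl⟩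
    have h2 := h1.eventually_le_const (show ‖G (-1) / G 0‖ < B by rw [hB]; linarith)
    refine summable_of_sum_le (c := B) (fun i => (one_div_pos.mpr (hx i)).le) fun S => ?_
    obtain ⟨R, hRB, hRS⟩ := (h2.and (hTtop.eventually_ge_atTop S)).exists
    have h3 : ‖∏ i ∈ T R, (1 - (-1) / (x i : ℂ))‖ = ∏ i ∈ T R, (1 + 1 / x i) := by
      rw [norm_prod]
      refine Finset.prod_congr rfl fun i _ => ?_
      have : (1 - (-1) / (x i : ℂ)) = ((1 + 1 / x i : ℝ) : ℂ) := by
        push_cast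
        ring
      rw [this, Complex.norm_real, Real.norm_of_nonneg]
      have := hx i
      positivity
    rw [h3] at hRB
    refine le_trans ?_ hRB
    calc ∑ i ∈ S, 1 / x i ≤ ∑ i ∈ T R, 1 / x i :=
          Finset.sum_le_sum_of_subset_of_nonneg hRS fun i _ _ => (one_div_pos.mpr (hx i)).le
      _ ≤ 1 + ∑ i ∈ T R, 1 / x i := by linarith
      _ ≤ ∏ i ∈ T R, (1 + 1 / x i) :=
          one_add_sum_le_prod_one_add _ fun i => (one_div_pos.mpr (hx i)).le
  refine ⟨hsum, fun w => ?_⟩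
  have h1 : Multipliable (fun i => 1 - w / (x i : ℂ)) := by
    have h2 : Summable fun i => ‖-(w / (x i : ℂ))‖ := by
      refine (hsum.mul_left ‖w‖).congr fun i => ?_
      rw [norm_neg, norm_div, Complex.norm_real, Real.norm_of_nonneg (hx i).le]
      ring
    simpa [sub_eq_add_neg] using multipliable_one_add_of_summable h2
  have h2 := tendsto_nhds_unique (hlim w) (h1.hasProd.comp hTtop)
  rw [← h2]
  field_simp

/-! ### Power series and elementary symmetric functions -/

theorem summable_prod_subtype_card {ι : Type*} {a : ι → ℝ} (ha : ∀ i, 0 ≤ a i)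
    (hs : Summable a) (l : ℕ) :
    Summable (fun S : {S : Finset ι // S.card = l} => ∏ i ∈ S.1, a i) :=
  (summable_finsetProd_of_summable_nonneg ha hs).subtype _

/-- The power series of the canonical product `∏ (1 - w aᵢ)`: its coefficients are, up to sign, the
elementary symmetric functions of the `aᵢ`. -/
theorem hasSum_esymm_tprod_one_sub {ι : Type*} {a : ι → ℝ} (ha : ∀ i, 0 ≤ a i)
    (hs : Summable a) (w : ℂ) :
    HasSum (fun l : ℕ => (-1) ^ l *
      ((∑' S : {S : Finset ι // S.card = l}, ∏ i ∈ S.1, a i : ℝ) : ℂ) * w ^ l)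
      (∏' i, (1 - w * (a i : ℂ))) := by
  have h1 : Summable fun i => ‖-(w * (a i : ℂ))‖ := by
    refine (hs.mul_left ‖w‖).congr fun i => ?_
    rw [norm_neg, norm_mul, Complex.norm_real, Real.norm_of_nonneg (ha i)]
  have h2 := summable_finsetProd_of_summable_norm h1
  have h3 := h2.hasSum
  rw [← tprod_one_add h2] at h3
  simp only [← sub_eq_add_neg] at h3
  -- The product is an absolutely convergent sum over finite index sets; group these by cardinality.
  have h4 := ((Equiv.sigmaFiberEquiv (Finset.card (α := ι))).hasSum_iff.mpr h3).sigma
    (g := fun l => (-1) ^ l *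
      ((∑' S : {S : Finset ι // S.card = l}, ∏ i ∈ S.1, a i : ℝ) : ℂ) * w ^ l) ?_
  · exact h4
  · intro l
    have h5 := (Complex.hasSum_ofReal.mpr (summable_prod_subtype_card ha hs l).hasSum).mul_left
      ((-1) ^ l * w ^ l)
    rw [mul_right_comm] at h5
    refine h5.congr_fun ?_
    rintro ⟨S, rfl⟩
    simp only [Function.comp_apply, Equiv.sigmaFiberEquiv_apply]
    rw [Finset.prod_neg, Finset.prod_mul_distrib, Finset.prod_const]
    push_cast
    ring

theorem eq_of_hasSum_pow {a b : ℕ → ℂ} {G : ℂ → ℂ}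
    (ha : ∀ w, HasSum (fun n => a n * w ^ n) (G w))
    (hb : ∀ w, HasSum (fun n => b n * w ^ n) (G w)) : a = b := by
  have key : ∀ c : ℕ → ℂ, (∀ w, HasSum (fun n => c n * w ^ n) (G w)) →
      HasFPowerSeriesAt G (FormalMultilinearSeries.ofScalars ℂ c) 0 := by
    intro c hc
    rw [hasFPowerSeriesAt_iff]
    refine Filter.Eventually.of_forall fun w => ?_
    simpa [FormalMultilinearSeries.coeff_ofScalars, mul_comm] using hc w
  have h := (key a ha).eq_formalMultilinearSeries (key b hb)
  ext n
  have := congrArg (fun p : FormalMultilinearSeries ℂ ℂ ℂ => p.coeff n) h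
  simpa [FormalMultilinearSeries.coeff_ofScalars] using this

theorem differentiable_of_hasSum_pow {a : ℕ → ℂ} {G : ℂ → ℂ}
    (ha : ∀ w, HasSum (fun n => a n * w ^ n) (G w)) : Differentiable ℂ G := by
  have hr : (FormalMultilinearSeries.ofScalars ℂ a).radius = ⊤ := by
    refine FormalMultilinearSeries.radius_eq_top_of_summable_norm _ fun r => ?_
    have := (ha r).summable.norm
    refine this.congr fun n => ?_
    rw [FormalMultilinearSeries.ofScalars_norm]
    simp
  have hb : HasFPowerSeriesOnBall G (FormalMultilinearSeries.ofScalars ℂ a) 0 ⊤ := by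
    refine ⟨hr.ge, ENNReal.zero_lt_top, fun {w} _ => ?_⟩
    simpa [FormalMultilinearSeries.ofScalars_apply_eq, mul_comm] using ha w
  have := hb.differentiableOn
  rwa [Metric.eball_top, differentiableOn_univ] at this

/-! ### Bounds for `Λ₀` from a positive Mellin kernel -/

-- The kernel is nonnegative: beyond `1` it is the theta series without its constant term, a sum of
-- positive exponentials, and below `1` the theta functional equation reflects it.
open HurwitzZeta in
theorem f_modif_hurwitzEvenFEPair_zero_eq_norm {x : ℝ} (hx : 0 < x) :
    (hurwitzEvenFEPair 0).f_modif x = (‖(hurwitzEvenFEPair 0).f_modif x‖ : ℂ) := by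
  have key : ∀ y : ℝ, 0 < y → 0 ≤ evenKernel 0 y - 1 := by
    intro y hy
    have h := hasSum_int_evenKernel₀ 0 hy
    rw [QuotientAddGroup.mk_zero, if_pos rfl] at h
    refine h.nonneg fun n => ?_
    split_ifs
    · exact le_rfl
    · exact (Real.exp_pos _).le
  suffices h : ∃ r : ℝ, 0 ≤ r ∧ (hurwitzEvenFEPair 0).f_modif x = (r : ℂ) by
    obtain ⟨r, hr, h⟩ := h
    rw [h, Complex.norm_real, Real.norm_of_nonneg hr]
  rcases lt_trichotomy x 1 with h1 | rfl | h1
  · have hx' : 1 < 1 / x := (one_lt_div hx).mpr h1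
    have hFE := (hurwitzEvenFEPair 0).hf_modif_FE (1 / x) (by positivity)
    rw [one_div_one_div] at hFE
    refine ⟨(1 / x) ^ (1 / 2 : ℝ) * (evenKernel 0 (1 / x) - 1),
      mul_nonneg (by positivity) (key _ (by positivity)), ?_⟩
    rw [hFE]
    simp only [WeakFEPair.g_modif, Pi.add_apply, Set.indicator_of_mem (Set.mem_Ioi.mpr hx'),
      Set.indicator_of_notMem (Set.notMem_Ioo_of_ge hx'.le)]
    simp [hurwitzEvenFEPair, evenKernel_eq_cosKernel_of_zero]
  -- Both indicators in the modified kernel exclude the point `1`.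
  · exact ⟨0, le_rfl, by simp [WeakFEPair.f_modif]⟩
  · refine ⟨evenKernel 0 x - 1, key x hx, ?_⟩
    simp only [WeakFEPair.f_modif, Pi.add_apply, Set.indicator_of_mem (Set.mem_Ioi.mpr h1),
      Set.indicator_of_notMem (Set.notMem_Ioo_of_ge h1.le)]
    simp [hurwitzEvenFEPair]

open HurwitzZeta MeasureTheory in
theorem integrableOn_rpow_mul_norm_f_modif (u : ℝ) :
    IntegrableOn (fun x : ℝ => x ^ (u - 1) * ‖(hurwitzEvenFEPair 0).f_modif x‖)
      (Set.Ioi 0) := by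
  have h := ((hurwitzEvenFEPair 0).isStrongFEPair_toStrongFEPair.hasMellin (u : ℂ)).1
  have h2 := Integrable.norm h
  refine (integrable_congr ?_).mp h2
  filter_upwards [ae_restrict_mem measurableSet_Ioi] with x hx
  rw [norm_smul, Complex.norm_cpow_eq_rpow_re_of_pos hx]
  simp [WeakFEPair.toStrongFEPair]

open HurwitzZeta MeasureTheory in
theorem completedRiemannZeta₀_eq_integral (s : ℂ) :
    completedRiemannZeta₀ s = (∫ x : ℝ in Set.Ioi 0,
      (x : ℂ) ^ (s / 2 - 1) * (‖(hurwitzEvenFEPair 0).f_modif x‖ : ℂ)) / 2 := by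
  rw [completedRiemannZeta₀, completedHurwitzZetaEven₀, WeakFEPair.Λ₀, mellin]
  congr 1
  refine setIntegral_congr_fun measurableSet_Ioi fun x hx => ?_
  rw [← f_modif_hurwitzEvenFEPair_zero_eq_norm hx, smul_eq_mul]

open HurwitzZeta MeasureTheory in
theorem completedRiemannZeta₀_ofReal (σ : ℝ) :
    completedRiemannZeta₀ σ = (((∫ x : ℝ in Set.Ioi 0,
      x ^ (σ / 2 - 1) * ‖(hurwitzEvenFEPair 0).f_modif x‖) / 2 : ℝ) : ℂ) := by
  rw [completedRiemannZeta₀_eq_integral, Complex.ofReal_div, ← integral_complex_ofReal]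
  congr 1
  refine setIntegral_congr_fun measurableSet_Ioi fun x hx => ?_
  rw [Complex.ofReal_mul, Complex.ofReal_cpow (le_of_lt hx)]
  push_cast
  rfl

open HurwitzZeta MeasureTheory in
theorem norm_completedRiemannZeta₀_le_re (s : ℂ) :
    ‖completedRiemannZeta₀ s‖ ≤ (completedRiemannZeta₀ s.re).re := by
  rw [completedRiemannZeta₀_ofReal, Complex.ofReal_re, completedRiemannZeta₀_eq_integral, norm_div,
    Complex.norm_ofNat]
  gcongr
  refine (norm_integral_le_integral_norm _).trans_eq ?_
  refine setIntegral_congr_fun measurableSet_Ioi fun x hx => ?_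
  rw [norm_mul, Complex.norm_cpow_eq_rpow_re_of_pos hx, Complex.norm_real, norm_norm]
  simp

theorem rpow_add_rpow_le_of_abs_le {x v v' : ℝ} (hx : 0 < x) (h : |v| ≤ |v'|) :
    x ^ v + x ^ (-v) ≤ x ^ v' + x ^ (-v') := by
  have key : ∀ t : ℝ, x ^ t + x ^ (-t) = 2 * Real.cosh (Real.log x * t) := by
    intro t
    rw [Real.rpow_def_of_pos hx, Real.rpow_def_of_pos hx, Real.cosh_eq, mul_neg]
    ring
  rw [key, key]
  have : Real.cosh (Real.log x * v) ≤ Real.cosh (Real.log x * v') := by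
    rw [Real.cosh_le_cosh, abs_mul, abs_mul]
    gcongr
  linarith

-- Averaging the Mellin integral with its reflection under `s ↦ 1 - s` turns the power of `x` into a
-- hyperbolic cosine in `t - ½`, monotone in `|t - ½|` for each `x`.
open HurwitzZeta MeasureTheory in
theorem completedRiemannZeta₀_re_mono {σ τ : ℝ} (h : |σ - 1 / 2| ≤ |τ - 1 / 2|) :
    (completedRiemannZeta₀ σ).re ≤ (completedRiemannZeta₀ τ).re := by
  have key : ∀ t : ℝ, 4 * (completedRiemannZeta₀ t).re = ∫ x : ℝ in Set.Ioi 0,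
      x ^ (-(3 / 4) : ℝ) * (x ^ ((t - 1 / 2) / 2) + x ^ (-((t - 1 / 2) / 2))) *
        ‖(hurwitzEvenFEPair 0).f_modif x‖ := by
    intro t
    have h1 := completedRiemannZeta₀_ofReal t
    have h2 := completedRiemannZeta₀_ofReal (1 - t)
    have h3 := completedRiemannZeta₀_one_sub t
    rw [Complex.ofReal_sub, Complex.ofReal_one, h3] at h2
    have h4 : 4 * (completedRiemannZeta₀ t).re =
        2 * (completedRiemannZeta₀ t).re + 2 * (completedRiemannZeta₀ t).re := by ring
    rw [h4]
    nth_rewrite 1 [h1]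
    rw [h2, Complex.ofReal_re, Complex.ofReal_re, mul_div_cancel₀ _ two_ne_zero,
      mul_div_cancel₀ _ two_ne_zero, ← integral_add (integrableOn_rpow_mul_norm_f_modif _)
        (integrableOn_rpow_mul_norm_f_modif _)]
    refine setIntegral_congr_fun measurableSet_Ioi fun x hx => ?_
    rw [mul_add, ← Real.rpow_add hx, ← Real.rpow_add hx, add_mul]
    congr 3 <;> ring
  have hint : ∀ t : ℝ, IntegrableOn (fun x : ℝ =>
      x ^ (-(3 / 4) : ℝ) * (x ^ ((t - 1 / 2) / 2) + x ^ (-((t - 1 / 2) / 2))) *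
        ‖(hurwitzEvenFEPair 0).f_modif x‖) (Set.Ioi 0) := by
    intro t
    refine (integrable_congr ?_).mp ((integrableOn_rpow_mul_norm_f_modif (t / 2)).add
      (integrableOn_rpow_mul_norm_f_modif ((1 - t) / 2)))
    filter_upwards [ae_restrict_mem measurableSet_Ioi] with x hx
    rw [Pi.add_apply, mul_add, ← Real.rpow_add hx, ← Real.rpow_add hx, add_mul]
    congr 3 <;> ring
  have hle : 4 * (completedRiemannZeta₀ σ).re ≤ 4 * (completedRiemannZeta₀ τ).re := by
    rw [key, key]
    refine setIntegral_mono_on (hint σ) (hint τ) measurableSet_Ioi fun x hx => ?_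
    have hx' : 0 < x := hx
    gcongr ?_ * ?_
    gcongr ?_ * ?_
    refine rpow_add_rpow_le_of_abs_le hx' ?_
    rw [abs_div, abs_div]
    gcongr
  linarith

theorem riemannZeta_natCast_eq_ofReal {k : ℕ} (hk : 1 < k) :
    riemannZeta k = ((∑' n : ℕ, 1 / (n : ℝ) ^ k : ℝ) : ℂ) := by
  rw [zeta_nat_eq_tsum_of_gt_one hk]
  push_cast
  rfl

theorem completedRiemannZeta_two_mul_nat_add_two (n : ℕ) :
    completedRiemannZeta ((2 * n + 2 : ℕ) : ℂ) =
      ((n.factorial / Real.pi ^ (n + 1) * ∑' k : ℕ, 1 / (k : ℝ) ^ (2 * n + 2) : ℝ) : ℂ) := by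
  have h0 : ((2 * n + 2 : ℕ) : ℂ) ≠ 0 := Nat.cast_ne_zero.mpr (by omega)
  have hG : Complex.Gammaℝ ((2 * n + 2 : ℕ) : ℂ) =
      ((n.factorial / Real.pi ^ (n + 1) : ℝ) : ℂ) := by
    rw [Complex.Gammaℝ_def]
    have h1 : ((2 * n + 2 : ℕ) : ℂ) / 2 = (n : ℂ) + 1 := by push_cast; ring
    have h2 : -((2 * n + 2 : ℕ) : ℂ) / 2 = -((n + 1 : ℕ) : ℂ) := by push_cast; ring
    rw [h1, h2, Complex.Gamma_nat_eq_factorial, Complex.cpow_neg, Complex.cpow_natCast]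
    push_cast
    ring
  have hz := riemannZeta_def_of_ne_zero h0
  have hGne : Complex.Gammaℝ ((2 * n + 2 : ℕ) : ℂ) ≠ 0 :=
    Complex.Gammaℝ_ne_zero_of_re_pos (by rw [Complex.natCast_re]; positivity)
  rw [eq_div_iff hGne] at hz
  rw [← hz, hG, riemannZeta_natCast_eq_ofReal (by omega)]
  push_cast
  ring

theorem tsum_one_div_nat_pow_le (n : ℕ) :
    ∑' k : ℕ, 1 / (k : ℝ) ^ (2 * n + 2) ≤ Real.pi ^ 2 / 6 := by
  rw [← hasSum_zeta_two.tsum_eq]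
  refine Summable.tsum_le_tsum (fun k => ?_)
    (Real.summable_one_div_nat_pow.mpr (by omega)) hasSum_zeta_two.summable
  -- The term `k = 0` is `1 / 0 = 0` on both sides.
  rcases Nat.eq_zero_or_pos k with rfl | hk
  · simp
  · have : (1 : ℝ) ≤ k := by exact_mod_cast hk
    gcongr
    · omega

theorem one_le_tsum_one_div_nat_pow (n : ℕ) :
    1 ≤ ∑' k : ℕ, 1 / (k : ℝ) ^ (2 * n + 2) := by
  have h : Summable fun k : ℕ => 1 / (k : ℝ) ^ (2 * n + 2) :=
    Real.summable_one_div_nat_pow.mpr (by omega)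
  simpa using h.le_tsum 1 fun k _ => by positivity

/-- The two polar terms add up to something nonpositive, and `ζ(2n + 2) ≤ ζ(2) = π²/6` with `π ≤ 6`
absorbs the powers of `π`. -/
theorem completedRiemannZeta₀_re_le_factorial (n : ℕ) :
    (completedRiemannZeta₀ ((2 * n + 2 : ℝ) : ℂ)).re ≤ n.factorial := by
  have h := completedRiemannZeta_eq ((2 * n + 2 : ℕ) : ℂ)
  rw [completedRiemannZeta_two_mul_nat_add_two] at h
  have h1 : completedRiemannZeta₀ ((2 * n + 2 : ℝ) : ℂ) =
      ((n.factorial / Real.pi ^ (n + 1) * (∑' k : ℕ, 1 / (k : ℝ) ^ (2 * n + 2)) +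
        1 / (2 * n + 2) + 1 / (1 - (2 * n + 2)) : ℝ) : ℂ) := by
    have h2 : ((2 * n + 2 : ℝ) : ℂ) = ((2 * n + 2 : ℕ) : ℂ) := by push_cast; ring
    rw [h2]
    simp only [Complex.ofReal_add]
    rw [h]
    push_cast
    ring
  rw [h1, Complex.ofReal_re]
  have h3 := tsum_one_div_nat_pow_le n
  have hpi := Real.pi_gt_three
  have hpi4 := Real.pi_le_four
  have hn : (0 : ℝ) ≤ n := n.cast_nonneg
  have h4 : (1 : ℝ) / (2 * n + 2) + 1 / (1 - (2 * n + 2)) ≤ 0 := by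
    have : (1 : ℝ) / (1 - (2 * n + 2)) = -(1 / (2 * n + 1)) := by
      rw [show (1 : ℝ) - (2 * n + 2) = -(2 * n + 1) by ring, one_div_neg_eq_neg_one_div]
    rw [this]
    have : (1 : ℝ) / (2 * n + 2) ≤ 1 / (2 * n + 1) := by gcongr; norm_num
    linarith
  have h5 : (n.factorial : ℝ) / Real.pi ^ (n + 1) * ∑' k : ℕ, 1 / (k : ℝ) ^ (2 * n + 2) ≤
      n.factorial := by
    calc _ ≤ (n.factorial : ℝ) / Real.pi ^ (n + 1) * (Real.pi ^ 2 / 6) := by gcongr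
      _ = n.factorial * (Real.pi / 6 / Real.pi ^ n) := by field_simp; ring
      _ ≤ n.factorial * 1 := by
        gcongr
        rw [div_le_one (by positivity)]
        have : (1 : ℝ) ≤ Real.pi ^ n := one_le_pow₀ (by linarith)
        linarith
      _ = _ := mul_one _
  linarith

theorem norm_completedRiemannZeta₀_le_factorial {s : ℂ} {n : ℕ}
    (h : |s.re - 1 / 2| ≤ 2 * n + 3 / 2) : ‖completedRiemannZeta₀ s‖ ≤ n.factorial := by
  refine (norm_completedRiemannZeta₀_le_re s).trans
    ((completedRiemannZeta₀_re_mono ?_).trans (completedRiemannZeta₀_re_le_factorial n))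
  have hn : (0 : ℝ) ≤ n := n.cast_nonneg
  rw [abs_of_nonneg (show (0 : ℝ) ≤ 2 * n + 2 - 1 / 2 by linarith)]
  linarith

/-! ### Size of `ξ` -/

/-- A zero would force `Λ₀(½) = 4`, against the bound `0! = 1`. -/
theorem riemannXi_one_half_ne_zero : riemannXi (1 / 2) ≠ 0 := by
  have h : ‖completedRiemannZeta₀ (1 / 2)‖ ≤ (0 : ℕ).factorial :=
    norm_completedRiemannZeta₀_le_factorial (by norm_num)
  intro h0
  rw [riemannXi, div_eq_zero_iff, or_iff_left two_ne_zero] at h0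
  have h1 : completedRiemannZeta₀ (1 / 2) = 4 := by linear_combination -4 * h0
  rw [h1] at h
  norm_num at h

theorem differentiable_riemannXi : Differentiable ℂ riemannXi := by
  have := differentiable_completedZeta₀
  unfold riemannXi
  fun_prop

theorem riemannXi_one_sub (s : ℂ) : riemannXi (1 - s) = riemannXi s := by
  rw [riemannXi, riemannXi, completedRiemannZeta₀_one_sub]
  ring

theorem exists_factorial_le_mul_exp_sq {ε : ℝ} (hε : 0 < ε) :
    ∃ C : ℝ, 0 ≤ C ∧ ∀ n : ℕ, (n.factorial : ℝ) ≤ C * Real.exp (ε * n ^ 2) := by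
  have h1 : ∀ᶠ n : ℕ in Filter.atTop, (n : ℝ) ≤ Real.exp (ε * n) := by
    have h2 := (isLittleO_pow_exp_pos_mul_atTop 1 hε).bound one_pos
    filter_upwards [tendsto_natCast_atTop_atTop.eventually h2] with n hn
    simpa using hn
  obtain ⟨N, hN⟩ := Filter.eventually_atTop.mp h1
  refine ⟨N.factorial, Nat.cast_nonneg _, fun n => ?_⟩
  rcases le_total N n with h | h
  · calc (n.factorial : ℝ) ≤ (n : ℝ) ^ n := by exact_mod_cast Nat.factorial_le_pow n
      _ ≤ Real.exp (ε * n) ^ n := by gcongr; exact hN n h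
      _ = 1 * Real.exp (ε * n ^ 2) := by rw [← Real.exp_nat_mul, one_mul]; congr 1; ring
      _ ≤ _ := by
        gcongr
        exact_mod_cast N.factorial_pos
  · calc (n.factorial : ℝ) ≤ N.factorial * 1 := by
          rw [mul_one]; exact_mod_cast Nat.factorial_le h
      _ ≤ _ := by
        gcongr
        exact Real.one_le_exp (by positivity)

/-- `ξ(½ + i x)` is of order less than two. -/
theorem exists_norm_riemannXi_le {ε : ℝ} (hε : 0 < ε) :
    ∃ C : ℝ, ∀ x : ℂ, ‖2 * riemannXi (1 / 2 + Complex.I * x)‖ ≤ C * Real.exp (ε * ‖x‖ ^ 2) := by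
  obtain ⟨D, hD0, hD⟩ := exists_factorial_le_mul_exp_sq (show 0 < ε / 3 by positivity)
  -- One third of `ε` pays for the quadratic factor, two thirds for the factorial, as `(r + 1)² ≤
  -- 2r² + 2`.
  set δ := ε / 3 with hδ
  have hδ0 : 0 < δ := by positivity
  refine ⟨1 + (2 + 2 / δ) * (D * Real.exp (2 * δ)), fun x => ?_⟩
  set r := ‖x‖ with hr
  have hr0 : 0 ≤ r := norm_nonneg x
  have hΛ : ‖completedRiemannZeta₀ (1 / 2 + Complex.I * x)‖ ≤ (⌈r⌉₊.factorial : ℝ) := by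
    apply norm_completedRiemannZeta₀_le_factorial
    have h1 : (1 / 2 + Complex.I * x).re - 1 / 2 = -x.im := by simp
    rw [h1, abs_neg]
    have h2 := Complex.abs_im_le_norm x
    have h3 := Nat.le_ceil r
    linarith
  have hfac : (⌈r⌉₊.factorial : ℝ) ≤ D * Real.exp (2 * δ) * Real.exp (2 * δ * r ^ 2) := by
    refine (hD _).trans ?_
    rw [mul_assoc, ← Real.exp_add]
    gcongr
    have h1 : (⌈r⌉₊ : ℝ) ≤ r + 1 := (Nat.ceil_lt_add_one hr0).le
    have h2 : (⌈r⌉₊ : ℝ) ^ 2 ≤ (r + 1) ^ 2 := by gcongr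
    nlinarith [sq_nonneg (r - 1)]
  have hquad : (r + 1) ^ 2 ≤ (2 + 2 / δ) * Real.exp (δ * r ^ 2) := by
    have h1 := Real.add_one_le_exp (δ * r ^ 2)
    have h2 : (2 + 2 / δ) * (δ * r ^ 2 + 1) = 2 * δ * r ^ 2 + 2 + 2 * r ^ 2 + 2 / δ := by
      field_simp
      ring
    have h3 : (2 + 2 / δ) * (δ * r ^ 2 + 1) ≤ (2 + 2 / δ) * Real.exp (δ * r ^ 2) := by gcongr
    have h4 : 0 ≤ 2 / δ := by positivity
    have h5 : 0 ≤ 2 * δ * r ^ 2 := by positivity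
    nlinarith [sq_nonneg (r - 1)]
  have hpoly : ‖(1 / 2 + Complex.I * x) * (1 / 2 + Complex.I * x - 1)‖ ≤ (r + 1) ^ 2 := by
    rw [norm_mul, sq]
    have h1 : ‖Complex.I * x‖ = r := by simp [hr]
    gcongr
    · refine (norm_add_le _ _).trans ?_
      rw [h1]
      norm_num
      linarith
    · rw [show (1 / 2 + Complex.I * x - 1 : ℂ) = Complex.I * x - 1 / 2 by ring]
      refine (norm_sub_le _ _).trans ?_
      rw [h1]
      norm_num
  calc ‖2 * riemannXi (1 / 2 + Complex.I * x)‖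
      = ‖1 + (1 / 2 + Complex.I * x) * (1 / 2 + Complex.I * x - 1) *
          completedRiemannZeta₀ (1 / 2 + Complex.I * x)‖ := by
        rw [riemannXi, mul_div_cancel₀ _ two_ne_zero]
    _ ≤ 1 + (r + 1) ^ 2 * (⌈r⌉₊.factorial : ℝ) := by
        refine (norm_add_le _ _).trans ?_
        rw [norm_one, norm_mul]
        gcongr
    _ ≤ 1 * Real.exp (ε * r ^ 2) + (2 + 2 / δ) * Real.exp (δ * r ^ 2) *
          (D * Real.exp (2 * δ) * Real.exp (2 * δ * r ^ 2)) := by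
        gcongr
        rw [one_mul]
        exact Real.one_le_exp (by positivity)
    _ = (1 + (2 + 2 / δ) * (D * Real.exp (2 * δ))) * Real.exp (ε * r ^ 2) := by
        have : Real.exp (ε * r ^ 2) = Real.exp (δ * r ^ 2) * Real.exp (2 * δ * r ^ 2) := by
          rw [← Real.exp_add, hδ]
          congr 1
          ring
        rw [this]
        ring

/-- Used to show that `ξ` outgrows what finitely many zeros would allow; it rests on `ζ(2n + 2) ≥
1`. -/
theorem factorial_div_pi_pow_le_norm_riemannXi (n : ℕ) :
    n.factorial / Real.pi ^ (n + 1) ≤ ‖riemannXi ((2 * n + 2 : ℕ) : ℂ)‖ := by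
  have h0 : ((2 * n + 2 : ℕ) : ℂ) ≠ 0 := Nat.cast_ne_zero.mpr (by omega)
  have h1 : (1 - ((2 * n + 2 : ℕ) : ℂ)) ≠ 0 := by
    rw [sub_ne_zero, ne_comm, Nat.cast_ne_one]
    omega
  have h2 : riemannXi ((2 * n + 2 : ℕ) : ℂ) =
      (((n + 1) * (2 * n + 1) * (n.factorial / Real.pi ^ (n + 1) *
        ∑' k : ℕ, 1 / (k : ℝ) ^ (2 * n + 2)) : ℝ) : ℂ) := by
    have h := completedRiemannZeta_eq ((2 * n + 2 : ℕ) : ℂ)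
    rw [completedRiemannZeta_two_mul_nat_add_two] at h
    have h3 : riemannXi ((2 * n + 2 : ℕ) : ℂ) = ((2 * n + 2 : ℕ) : ℂ) *
        (((2 * n + 2 : ℕ) : ℂ) - 1) * (completedRiemannZeta₀ ((2 * n + 2 : ℕ) : ℂ) -
          1 / ((2 * n + 2 : ℕ) : ℂ) - 1 / (1 - ((2 * n + 2 : ℕ) : ℂ))) / 2 := by
      rw [riemannXi]
      field_simp
      ring
    rw [h3, ← h]
    push_cast
    ring
  have h4 := one_le_tsum_one_div_nat_pow n
  have hn : (0 : ℝ) ≤ n := n.cast_nonneg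
  have h5 : (1 : ℝ) ≤ (n + 1) * (2 * n + 1) := by nlinarith
  have h6 : 0 ≤ n.factorial / Real.pi ^ (n + 1) := by positivity
  rw [h2, Complex.norm_real]
  refine le_trans ?_ (Real.le_norm_self _)
  calc n.factorial / Real.pi ^ (n + 1) = 1 * (n.factorial / Real.pi ^ (n + 1) * 1) := by ring
    _ ≤ _ := by gcongr

/-! ### Taylor expansion at `½` and the function `xiSquare` -/

theorem hasSum_jensenCoeff (x : ℂ) :
    HasSum (fun n : ℕ => jensenCoeff n * x ^ (2 * n) / (n.factorial : ℂ))
      (2 * riemannXi (1 / 2 + Complex.I * x)) := by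
  have h1 := (Complex.hasSum_taylorSeries_of_entire differentiable_riemannXi (1 / 2)
    (1 / 2 + Complex.I * x)).mul_left 2
  -- Differentiating `ξ(1 - s) = ξ(s)` an odd number of times at the fixed point `½` changes the
  -- sign.
  have hodd : ∀ n, Odd n → iteratedDeriv n riemannXi (1 / 2) = 0 := by
    intro n hn
    have h2 := congrFun (iteratedDeriv_comp_const_sub n riemannXi (1 : ℂ)) (1 / 2)
    simp only [riemannXi_one_sub, hn.neg_one_pow] at h2
    norm_num at h2
    have h3 : (2 : ℂ) * iteratedDeriv n riemannXi (1 / 2) = 0 := by linear_combination h2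
    simpa using h3
  have hinj : Function.Injective fun n : ℕ => 2 * n := mul_right_injective₀ two_ne_zero
  rw [← hinj.hasSum_iff] at h1
  · refine h1.congr_fun fun n => ?_
    have hn : (n.factorial : ℂ) ≠ 0 := Nat.cast_ne_zero.mpr n.factorial_ne_zero
    have hn2 : ((2 * n).factorial : ℂ) ≠ 0 := Nat.cast_ne_zero.mpr (2 * n).factorial_ne_zero
    simp only [Function.comp_apply, smul_eq_mul, jensenCoeff, xiTaylorCoeff]
    rw [add_sub_cancel_left, mul_pow, pow_mul Complex.I, Complex.I_sq]
    field_simp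
  · intro n hn
    have : Odd n := by
      rw [← Nat.not_even_iff_odd]
      rintro ⟨m, rfl⟩
      exact hn ⟨m, by simp only; ring⟩
    rw [hodd n this]
    simp

theorem jensenCoeff_zero : jensenCoeff 0 = 2 * riemannXi (1 / 2) := by
  simp [jensenCoeff, xiTaylorCoeff]

theorem jensenCoeff_zero_ne_zero : jensenCoeff 0 ≠ 0 := by
  rw [jensenCoeff_zero]
  exact mul_ne_zero two_ne_zero riemannXi_one_half_ne_zero

theorem jensenCoeff_zero_eq : jensenCoeff 0 =
    -(Complex.Gamma (1 / 4) * riemannZeta (1 / 2)) / (4 * (Real.pi : ℂ) ^ (1 / 4 : ℂ)) := by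
  rw [jensenCoeff_zero, riemannXi_eq (by norm_num) (by norm_num),
    show (-(1 / 2) / 2 : ℂ) = -(1 / 4) by norm_num, show (1 / 2 / 2 : ℂ) = 1 / 4 by norm_num,
    Complex.cpow_neg]
  have hpi : (Real.pi : ℂ) ^ (1 / 4 : ℂ) ≠ 0 := by
    simp [Complex.cpow_eq_zero_iff, Real.pi_ne_zero]
  field_simp
  norm_num

/-- The entire function `G` with `G(x²) = 2 ξ(½ + i x)`. -/
noncomputable def xiSquare (w : ℂ) : ℂ := ∑' n : ℕ, jensenCoeff n / (n.factorial : ℂ) * w ^ n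

theorem xiSquare_sq (x : ℂ) : xiSquare (x ^ 2) = 2 * riemannXi (1 / 2 + Complex.I * x) := by
  rw [← (hasSum_jensenCoeff x).tsum_eq, xiSquare]
  congr 1
  ext n
  rw [pow_mul]
  ring

theorem hasSum_xiSquare (w : ℂ) :
    HasSum (fun n : ℕ => jensenCoeff n / (n.factorial : ℂ) * w ^ n) (xiSquare w) := by
  obtain ⟨x, rfl⟩ := IsAlgClosed.exists_pow_nat_eq w two_pos
  rw [xiSquare_sq]
  refine (hasSum_jensenCoeff x).congr_fun fun n => ?_
  rw [pow_mul]
  ring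

theorem differentiable_xiSquare : Differentiable ℂ xiSquare :=
  differentiable_of_hasSum_pow hasSum_xiSquare

theorem xiSquare_zero : xiSquare 0 = jensenCoeff 0 := by
  rw [jensenCoeff_zero, ← zero_pow two_ne_zero, xiSquare_sq]
  simp

theorem exists_norm_xiSquare_le {ε : ℝ} (hε : 0 < ε) :
    ∃ C : ℝ, ∀ w : ℂ, ‖xiSquare w‖ ≤ C * Real.exp (ε * ‖w‖) := by
  obtain ⟨C, hC⟩ := exists_norm_riemannXi_le hε
  refine ⟨C, fun w => ?_⟩
  obtain ⟨x, rfl⟩ := IsAlgClosed.exists_pow_nat_eq w two_pos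
  rw [xiSquare_sq, norm_pow]
  exact hC x

/-! ### Zeros and multiplicities under RH -/

theorem analyticOrderAt_riemannZeta_eq_riemannXi {s : ℂ} (hs : 0 < s.re) (hs1 : s ≠ 1) :
    analyticOrderAt riemannZeta s = analyticOrderAt (fun z => 2 * riemannXi z) s := by
  have hs0 : s ≠ 0 := by
    rintro rfl
    simp at hs
  have hu : AnalyticAt ℂ (fun z : ℂ => (z * (z - 1))⁻¹ * (Complex.Gammaℝ z)⁻¹) s := by
    refine AnalyticAt.mul (AnalyticAt.inv ?_ ?_)
      (Complex.differentiable_Gammaℝ_inv.analyticAt s)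
    · fun_prop
    · exact mul_ne_zero hs0 (sub_ne_zero.mpr hs1)
  have hune : (fun z : ℂ => (z * (z - 1))⁻¹ * (Complex.Gammaℝ z)⁻¹) s ≠ 0 :=
    mul_ne_zero (inv_ne_zero (mul_ne_zero hs0 (sub_ne_zero.mpr hs1)))
      (inv_ne_zero (Complex.Gammaℝ_ne_zero_of_re_pos hs))
  have hxi : AnalyticAt ℂ (fun z => 2 * riemannXi z) s :=
    (differentiable_riemannXi.const_mul 2).analyticAt s
  have heq : riemannZeta =ᶠ[nhds s]
      (fun z : ℂ => (z * (z - 1))⁻¹ * (Complex.Gammaℝ z)⁻¹) * fun z => 2 * riemannXi z := by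
    have h1 : ∀ᶠ z : ℂ in nhds s, 0 < z.re :=
      Complex.continuous_re.continuousAt.eventually_const_lt hs
    filter_upwards [h1, isOpen_ne.eventually_mem hs1, isOpen_ne.eventually_mem hs0]
      with z hz hz1 hz0
    have hG := Complex.Gammaℝ_ne_zero_of_re_pos hz
    have hz1' : z - 1 ≠ 0 := sub_ne_zero.mpr hz1
    simp only [Pi.mul_apply]
    rw [riemannXi_eq hz hz1, show 1 / 2 * z * (z - 1) * (Real.pi : ℂ) ^ (-z / 2) *
      Complex.Gamma (z / 2) * riemannZeta z = 1 / 2 * z * (z - 1) *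
      ((Real.pi : ℂ) ^ (-z / 2) * Complex.Gamma (z / 2)) * riemannZeta z by ring,
      ← Complex.Gammaℝ_def]
    field_simp
  rw [analyticOrderAt_congr heq, analyticOrderAt_mul hu hxi,
    hu.analyticOrderAt_eq_zero.mpr hune, zero_add]

/-- Squaring is locally biholomorphic away from `0`, so it preserves orders. -/
theorem analyticOrderAt_xiSquare_sq {x : ℂ} (hx : x ≠ 0) :
    analyticOrderAt xiSquare (x ^ 2) =
      analyticOrderAt (fun z => 2 * riemannXi z) (1 / 2 + Complex.I * x) := by
  have h1 : AnalyticAt ℂ (fun z : ℂ => z ^ 2) x := by fun_prop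
  have h2 : AnalyticAt ℂ (fun z : ℂ => 1 / 2 + Complex.I * z) x := by fun_prop
  have h3 := analyticOrderAt_comp_of_deriv_ne_zero (f := xiSquare) h1 (by simpa using hx)
  have h4 := analyticOrderAt_comp_of_deriv_ne_zero (f := fun z => 2 * riemannXi z) h2 (by simp)
  rw [← h3, ← h4]
  congr 1
  ext z
  exact xiSquare_sq z

/-- To the right of `½` a zero of `ξ` is a nontrivial zero of `ζ`; the functional equation reflects
the rest. -/
theorem re_eq_one_half_of_riemannXi_eq_zero (hRH : RiemannHypothesis) {s : ℂ}
    (hs : riemannXi s = 0) : s.re = 1 / 2 := by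
  have key : ∀ u : ℂ, riemannXi u = 0 → 1 / 2 ≤ u.re → u.re = 1 / 2 := by
    intro u hu hre
    have hre0 : 0 < u.re := by linarith
    have hu0 : u ≠ 0 := by
      rintro rfl
      simp at hre0
    have hu1 : u ≠ 1 := by
      rintro rfl
      simp [riemannXi] at hu
    have hG := Complex.Gammaℝ_ne_zero_of_re_pos hre0
    rw [riemannXi_eq hre0 hu1, mul_assoc _ _ (Complex.Gamma _), ← Complex.Gammaℝ_def] at hu
    have hz : riemannZeta u = 0 := by
      simpa [hu0, hG, sub_ne_zero.mpr hu1] using hu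
    refine hRH u hz ?_ hu1
    rintro ⟨n, rfl⟩
    have hn : (0 : ℝ) ≤ n := n.cast_nonneg
    simp at hre0
    linarith
  rcases le_total (1 / 2) s.re with h | h
  · exact key s hs h
  · have h1 := key (1 - s) (by rw [riemannXi_one_sub, hs])
      (by rw [Complex.sub_re, Complex.one_re]; linarith)
    rw [Complex.sub_re, Complex.one_re] at h1
    linarith

section Zeros

variable {ι : Type*} {s : ι → ℂ}

theorem eq_one_half_add_im_mul_I (hRH : RiemannHypothesis)
    (him : ∀ r, 0 < (s r).im) (hpos : ∀ r, 0 < (s r).re) (hlt : ∀ r, (s r).re < 1)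
    (hmult : ∀ ρ : ℂ, 0 < ρ.re → ρ.re < 1 → 0 < ρ.im →
      {r | s r = ρ}.encard = analyticOrderAt riemannZeta ρ) (r : ι) :
    s r = 1 / 2 + Complex.I * ((s r).im : ℂ) := by
  have h1 : riemannZeta (s r) = 0 := by
    apply apply_eq_zero_of_analyticOrderAt_ne_zero
    rw [← hmult _ (hpos r) (hlt r) (him r), Set.encard_ne_zero]
    exact ⟨r, rfl⟩
  have h2 : (s r).re = 1 / 2 := by
    refine hRH _ h1 ?_ ?_
    · rintro ⟨n, hn⟩
      have := him r
      rw [hn] at this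
      simp at this
    · intro h
      have := him r
      rw [h] at this
      simp at this
  apply Complex.ext
  · simp [h2]
  · simp

theorem encard_sq_im_eq_analyticOrderAt (hRH : RiemannHypothesis)
    (him : ∀ r, 0 < (s r).im) (hpos : ∀ r, 0 < (s r).re) (hlt : ∀ r, (s r).re < 1)
    (hmult : ∀ ρ : ℂ, 0 < ρ.re → ρ.re < 1 → 0 < ρ.im →
      {r | s r = ρ}.encard = analyticOrderAt riemannZeta ρ) (w : ℂ) :
    {r | (((s r).im ^ 2 : ℝ) : ℂ) = w}.encard = analyticOrderAt xiSquare w := by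
  by_cases hw : ∃ t : ℝ, 0 < t ∧ w = (t : ℂ) ^ 2
  · obtain ⟨t, ht, rfl⟩ := hw
    have htc : (t : ℂ) ≠ 0 := Complex.ofReal_ne_zero.mpr ht.ne'
    have hre : ((1 / 2 : ℂ) + Complex.I * t).re = 1 / 2 := by simp
    have him' : ((1 / 2 : ℂ) + Complex.I * t).im = t := by simp
    rw [analyticOrderAt_xiSquare_sq htc, ← analyticOrderAt_riemannZeta_eq_riemannXi, ← hmult]
    · congr 1
      ext r
      simp only [Set.mem_ofPred_eq]
      constructor
      · intro h
        rw [← Complex.ofReal_pow, Complex.ofReal_inj,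
          pow_left_inj₀ (him r).le ht.le two_ne_zero] at h
        rw [eq_one_half_add_im_mul_I hRH him hpos hlt hmult r, h]
      · intro h
        rw [h, him']
        push_cast
        rfl
    · rw [hre]; norm_num
    · rw [hre]; norm_num
    · rwa [him']
    · rw [hre]; norm_num
    · intro h
      rw [h] at hre
      norm_num at hre
  · have h1 : {r | (((s r).im ^ 2 : ℝ) : ℂ) = w} = ∅ := by
      rw [Set.eq_empty_iff_forall_notMem]
      intro r hr
      exact hw ⟨(s r).im, him r, by rw [← Complex.ofReal_pow]; exact hr.symm⟩
    rw [h1, Set.encard_empty, eq_comm,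
      (differentiable_xiSquare.analyticAt w).analyticOrderAt_eq_zero]
    intro h0
    obtain ⟨x, rfl⟩ := IsAlgClosed.exists_pow_nat_eq w two_pos
    rw [xiSquare_sq, mul_eq_zero, or_iff_right two_ne_zero] at h0
    have h2 := re_eq_one_half_of_riemannXi_eq_zero hRH h0
    have hxim : x.im = 0 := by simpa using h2
    have hx : x = (x.re : ℂ) := Complex.ext rfl (by simpa using hxim)
    have hx0 : x.re ≠ 0 := by
      intro h
      rw [hx, h] at h0
      simp only [Complex.ofReal_zero, mul_zero, add_zero] at h0
      exact riemannXi_one_half_ne_zero h0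
    refine hw ⟨|x.re|, abs_pos.mpr hx0, ?_⟩
    rw [← Complex.ofReal_pow, sq_abs, Complex.ofReal_pow, ← hx]

theorem summable_and_xiSquare_eq_tprod (hRH : RiemannHypothesis)
    (him : ∀ r, 0 < (s r).im) (hpos : ∀ r, 0 < (s r).re) (hlt : ∀ r, (s r).re < 1)
    (hmult : ∀ ρ : ℂ, 0 < ρ.re → ρ.re < 1 → 0 < ρ.im →
      {r | s r = ρ}.encard = analyticOrderAt riemannZeta ρ) :
    Summable (fun r => 1 / (s r).im ^ 2) ∧
      ∀ w, xiSquare w = jensenCoeff 0 * ∏' r, (1 - w / (((s r).im ^ 2 : ℝ) : ℂ)) := by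
  rw [← xiSquare_zero]
  exact summable_and_eq_tprod_of_zeros_pos differentiable_xiSquare
    (by rw [xiSquare_zero]; exact jensenCoeff_zero_ne_zero)
    (fun r => pow_pos (him r) 2)
    (encard_sq_im_eq_analyticOrderAt hRH him hpos hlt hmult)
    fun ε hε => exists_norm_xiSquare_le hε

/-- With finitely many zeros the product is a polynomial, so `ξ(2n + 2)` would be at most
exponential in `n`, whereas it exceeds `n!/π^(n+1)`. -/
theorem infinite_of_forall_encard_eq (hRH : RiemannHypothesis)
    (him : ∀ r, 0 < (s r).im) (hpos : ∀ r, 0 < (s r).re) (hlt : ∀ r, (s r).re < 1)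
    (hmult : ∀ ρ : ℂ, 0 < ρ.re → ρ.re < 1 → 0 < ρ.im →
      {r | s r = ρ}.encard = analyticOrderAt riemannZeta ρ) : Infinite ι := by
  rw [← not_finite_iff_infinite]
  intro hfin
  have := Fintype.ofFinite ι
  have hprod := (summable_and_xiSquare_eq_tprod hRH him hpos hlt hmult).2
  simp only [tprod_fintype] at hprod
  set N := Fintype.card ι with hN
  set D := ∏ r : ι, (1 + 1 / (s r).im ^ 2) with hD
  have hDpos : 0 ≤ D := Finset.prod_nonneg fun r _ => by positivity
  -- a polynomial bound of degree `N`
  have hpoly : ∀ w : ℂ, ‖xiSquare w‖ ≤ ‖jensenCoeff 0‖ * (D * (1 + ‖w‖) ^ N) := by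
    intro w
    rw [hprod w, norm_mul, norm_prod, hD, hN, ← Finset.card_univ, ← Finset.prod_const,
      ← Finset.prod_mul_distrib]
    gcongr with r _
    refine (norm_sub_le _ _).trans ?_
    rw [norm_one, norm_div, Complex.norm_real, Real.norm_of_nonneg (sq_nonneg _)]
    have h1 : 0 ≤ 1 / (s r).im ^ 2 := by positivity
    have h2 : 0 ≤ ‖w‖ := norm_nonneg w
    rw [div_eq_mul_one_div]
    nlinarith
  have hbound : ∀ n : ℕ, (n.factorial : ℝ) ≤ (‖jensenCoeff 0‖ * D * (2 * N).factorial *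
      Real.exp 3 * Real.pi) * (Real.pi * Real.exp 2) ^ n := by
    intro n
    have hn : (0 : ℝ) ≤ n := n.cast_nonneg
    have h1 := factorial_div_pi_pow_le_norm_riemannXi n
    -- This `x` is chosen so that `½ + i x = 2n + 2`.
    have h2 := hpoly ((-Complex.I * (2 * n + 3 / 2)) ^ 2)
    have h3 : (1 / 2 : ℂ) + Complex.I * (-Complex.I * (2 * n + 3 / 2)) =
        ((2 * n + 2 : ℕ) : ℂ) := by
      have := Complex.I_mul_I
      push_cast
      linear_combination (-(2 * n + 3 / 2 : ℂ)) * this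
    rw [xiSquare_sq, h3, norm_mul, Complex.norm_ofNat, norm_pow, norm_mul, norm_neg,
      Complex.norm_I, one_mul] at h2
    have h4 : ‖(2 * n + 3 / 2 : ℂ)‖ = 2 * n + 3 / 2 := by
      rw [show (2 * n + 3 / 2 : ℂ) = ((2 * n + 3 / 2 : ℝ) : ℂ) by push_cast; ring,
        Complex.norm_real, Real.norm_of_nonneg (by positivity)]
    rw [h4] at h2
    have h5 : (1 + (2 * n + 3 / 2 : ℝ) ^ 2) ^ N ≤
        (2 * N).factorial * (Real.exp 3 * Real.exp 2 ^ n) := by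
      calc (1 + (2 * n + 3 / 2 : ℝ) ^ 2) ^ N ≤ ((2 * n + 3 : ℝ) ^ 2) ^ N := by
            gcongr
            nlinarith
        _ = (2 * n + 3 : ℝ) ^ (2 * N) := by rw [pow_mul]
        _ ≤ (2 * N).factorial * Real.exp (2 * n + 3) := by
            have := Real.pow_div_factorial_le_exp (2 * n + 3 : ℝ) (by positivity) (2 * N)
            rwa [div_le_iff₀' (by positivity)] at this
        _ = _ := by
            rw [← Real.exp_nat_mul, ← Real.exp_add]
            congr 2
            ring
    rw [div_le_iff₀ (by positivity)] at h1
    have h6 : ‖riemannXi ((2 * n + 2 : ℕ) : ℂ)‖ ≤ ‖jensenCoeff 0‖ * (D *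
        ((2 * N).factorial * (Real.exp 3 * Real.exp 2 ^ n))) := by
      have h7 : ‖jensenCoeff 0‖ * (D * (1 + (2 * n + 3 / 2 : ℝ) ^ 2) ^ N) ≤
          ‖jensenCoeff 0‖ * (D * ((2 * N).factorial * (Real.exp 3 * Real.exp 2 ^ n))) := by
        gcongr
      linarith [norm_nonneg (riemannXi ((2 * n + 2 : ℕ) : ℂ))]
    calc (n.factorial : ℝ) ≤ ‖riemannXi ((2 * n + 2 : ℕ) : ℂ)‖ * Real.pi ^ (n + 1) := h1
      _ ≤ ‖jensenCoeff 0‖ * (D * ((2 * N).factorial * (Real.exp 3 * Real.exp 2 ^ n))) *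
          Real.pi ^ (n + 1) := by gcongr
      _ = _ := by rw [mul_pow]; ring
  set K := ‖jensenCoeff 0‖ * D * (2 * N).factorial * Real.exp 3 * Real.pi with hK
  have hlim := (FloorSemiring.tendsto_pow_div_factorial_atTop (Real.pi * Real.exp 2)).const_mul K
  rw [mul_zero] at hlim
  obtain ⟨n, hn⟩ := (hlim.eventually_lt_const one_pos).exists
  have hfac : (0 : ℝ) < n.factorial := by exact_mod_cast n.factorial_pos
  rw [← mul_div_assoc, div_lt_one hfac] at hn
  exact absurd (hbound n) (not_le.mpr hn)

end Zeros

/-! ### Listing the zeros -/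

theorem exists_enumeratesUpperZeros (hRH : RiemannHypothesis) :
    ∃ s : ℕ → ℂ, EnumeratesUpperZeros s := by
  have hne : ∀ ρ : ℂ, 0 < ρ.im → analyticOrderAt riemannZeta ρ ≠ ⊤ := by
    intro ρ hρ
    have hρ1 : ρ ≠ 1 := by
      rintro rfl
      simp at hρ
    refine analyticOn_riemannZeta.analyticOrderAt_ne_top_of_isPreconnected (x := 2)
      (isConnected_compl_singleton_of_one_lt_rank (by simp) 1).isPreconnected (by simp) hρ1 ?_
    rw [(analyticOn_riemannZeta 2 (by simp)).analyticOrderAt_eq_zero.mpr]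
    · exact ENat.zero_ne_top
    · exact riemannZeta_ne_zero_of_one_le_re (by simp)
  let Z := {ρ : ℂ // 0 < ρ.re ∧ ρ.re < 1 ∧ 0 < ρ.im}
  -- Each zero gets as many copies as its order, and a nonzero contributes none. The product theorem
  -- applies to this type before it is known to be countable.
  let ι := Σ ρ : Z, Fin (analyticOrderNatAt riemannZeta ρ.1)
  let σ : ι → ℂ := fun i => i.1.1
  have hmult : ∀ ρ : ℂ, 0 < ρ.re → ρ.re < 1 → 0 < ρ.im →
      {r | σ r = ρ}.encard = analyticOrderAt riemannZeta ρ := by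
    intro ρ h0 h1 h2
    have h3 : {r | σ r = ρ} =
        Set.range (Sigma.mk (β := fun ρ : Z => Fin (analyticOrderNatAt riemannZeta ρ.1))
          ⟨ρ, h0, h1, h2⟩) := by
      ext ⟨⟨ρ', h'⟩, k⟩
      constructor
      · rintro rfl
        exact ⟨k, rfl⟩
      · rintro ⟨k', hk'⟩
        have := congrArg σ hk'
        exact this.symm
    rw [h3, ← Set.image_univ, sigma_mk_injective.encard_image, Set.encard_univ,
      ENat.card_eq_coe_fintype_card, Fintype.card_fin, Nat.cast_analyticOrderNatAt (hne ρ h2)]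
  have him : ∀ i, 0 < (σ i).im := fun i => i.1.2.2.2
  have hpos : ∀ i, 0 < (σ i).re := fun i => i.1.2.1
  have hlt : ∀ i, (σ i).re < 1 := fun i => i.1.2.2.1
  have hinf := infinite_of_forall_encard_eq hRH him hpos hlt hmult
  have hsum := (summable_and_xiSquare_eq_tprod hRH him hpos hlt hmult).1
  -- A summable family has countable support, and here no term vanishes.
  have hcount : Countable ι := by
    have h := hsum.countable_support
    rw [show (Function.support fun r => 1 / (σ r).im ^ 2) = Set.univ from ?_] at h
    · exact Set.countable_univ_iff.mp h
    · rw [Set.eq_univ_iff_forall]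
      intro r
      rw [Function.mem_support]
      have := him r
      positivity
  obtain ⟨e⟩ := nonempty_equiv_of_countable (α := ℕ) (β := ι)
  refine ⟨σ ∘ e, fun r => hpos _, fun r => hlt _, fun r => him _, fun ρ h0 h1 h2 => ?_⟩
  rw [← hmult ρ h0 h1 h2, ← e.injective.encard_image]
  congr 1
  ext i
  simp only [Set.mem_image, Set.mem_ofPred_eq, Function.comp_apply]
  constructor
  · rintro ⟨n, hn, rfl⟩
    exact hn
  · intro hi
    exact ⟨e.symm i, by simpa using hi, by simp⟩

/-! ### Coefficients, index sets and the second derivative -/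

theorem jensenCoeff_eq_esymm {a : ℕ → ℝ} (ha : ∀ i, 0 ≤ a i) (hs : Summable a)
    (hprod : ∀ w, xiSquare w = jensenCoeff 0 * ∏' i, (1 - w * (a i : ℂ))) (l : ℕ) :
    jensenCoeff l = (-1) ^ l * (l.factorial : ℂ) * jensenCoeff 0 *
      ((∑' S : {S : Finset ℕ // S.card = l}, ∏ r ∈ S.1, a r : ℝ) : ℂ) := by
  have h := eq_of_hasSum_pow hasSum_xiSquare (b := fun l => jensenCoeff 0 * ((-1) ^ l *
      ((∑' S : {S : Finset ℕ // S.card = l}, ∏ i ∈ S.1, a i : ℝ) : ℂ))) fun w => by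
    rw [hprod w]
    refine ((hasSum_esymm_tprod_one_sub ha hs w).mul_left (jensenCoeff 0)).congr_fun fun n => ?_
    ring
  have hl := congrFun h l
  have hfac : (l.factorial : ℂ) ≠ 0 := Nat.cast_ne_zero.mpr l.factorial_ne_zero
  rw [div_eq_iff hfac] at hl
  rw [hl]
  ring

/-- Sets of one index are indices. -/
noncomputable def singletonEquiv : ℕ ≃ {S : Finset ℕ // S.card = 1} :=
  Equiv.ofBijective (fun n => ⟨{n}, Finset.card_singleton n⟩) <| by
    constructor
    · intro a b h
      simpa using h
    · rintro ⟨S, hS⟩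
      obtain ⟨a, rfl⟩ := Finset.card_eq_one.mp hS
      exact ⟨a, rfl⟩

/-- Sets of two indices are increasing pairs. -/
noncomputable def ltPairEquiv : {p : ℕ × ℕ // p.1 < p.2} ≃ {S : Finset ℕ // S.card = 2} :=
  Equiv.ofBijective (fun p => ⟨{p.1.1, p.1.2}, Finset.card_pair p.2.ne⟩) <| by
    constructor
    · rintro ⟨⟨a, b⟩, hab⟩ ⟨⟨c, d⟩, hcd⟩ h
      simp only [Subtype.mk.injEq] at h
      have h1 : ∀ x, x ∈ ({a, b} : Finset ℕ) ↔ x ∈ ({c, d} : Finset ℕ) := fun x => by rw [h]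
      simp only [Finset.mem_insert, Finset.mem_singleton] at h1 hab hcd
      have ha := h1 a
      have hb := h1 b
      have hc := h1 c
      simp only [Subtype.mk.injEq, Prod.mk.injEq]
      omega
    · rintro ⟨S, hS⟩
      obtain ⟨a, b, hab, rfl⟩ := Finset.card_eq_two.mp hS
      rcases lt_or_gt_of_ne hab with h | h
      · exact ⟨⟨(a, b), h⟩, rfl⟩
      · exact ⟨⟨(b, a), h⟩, Subtype.ext (Finset.pair_comm b a)⟩

/-- Sets of three indices are increasing triples. -/
noncomputable def ltTripleEquiv :
    {p : ℕ × ℕ × ℕ // p.1 < p.2.1 ∧ p.2.1 < p.2.2} ≃ {S : Finset ℕ // S.card = 3} :=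
  Equiv.ofBijective (fun p => ⟨{p.1.1, p.1.2.1, p.1.2.2},
      Finset.card_eq_three.mpr ⟨_, _, _, p.2.1.ne, (p.2.1.trans p.2.2).ne, p.2.2.ne, rfl⟩⟩) <| by
    constructor
    · rintro ⟨⟨a, b, c⟩, hab, hbc⟩ ⟨⟨d, e, f⟩, hde, hef⟩ h
      simp only [Subtype.mk.injEq] at h
      have h1 : ∀ x, x ∈ ({a, b, c} : Finset ℕ) ↔ x ∈ ({d, e, f} : Finset ℕ) := fun x => by rw [h]
      simp only [Finset.mem_insert, Finset.mem_singleton] at h1 hab hbc hde hef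
      have ha := h1 a
      have hb := h1 b
      have hc := h1 c
      have hd := h1 d
      have he := h1 e
      have hf := h1 f
      simp only [Subtype.mk.injEq, Prod.mk.injEq]
      omega
    · rintro ⟨S, hS⟩
      have key : ∀ a b c : ℕ, a < b → b < c → S = {a, b, c} → ∃ p :
          {p : ℕ × ℕ × ℕ // p.1 < p.2.1 ∧ p.2.1 < p.2.2},
          ({p.1.1, p.1.2.1, p.1.2.2} : Finset ℕ) = S :=
        fun a b c hab hbc h => ⟨⟨(a, b, c), hab, hbc⟩, h.symm⟩
      suffices h : ∃ p : {p : ℕ × ℕ × ℕ // p.1 < p.2.1 ∧ p.2.1 < p.2.2},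
          ({p.1.1, p.1.2.1, p.1.2.2} : Finset ℕ) = S by
        obtain ⟨p, hp⟩ := h
        exact ⟨p, Subtype.ext hp⟩
      obtain ⟨a, b, c, hab, hac, hbc, hS⟩ := Finset.card_eq_three.mp hS
      have hperm : ∀ x y z : ℕ, (∀ i, (i = a ∨ i = b ∨ i = c) ↔ (i = x ∨ i = y ∨ i = z)) →
          S = {x, y, z} := by
        intro x y z h
        rw [hS]
        ext i
        simpa using h i
      -- Of the eight sign patterns, two are cyclic and impossible; the others are the six
      -- orderings.
      rcases lt_or_gt_of_ne hab with h1 | h1 <;> rcases lt_or_gt_of_ne hbc with h2 | h2 <;>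
        rcases lt_or_gt_of_ne hac with h3 | h3
      · exact key a b c h1 h2 (hperm _ _ _ (by tauto))
      · omega
      · exact key a c b h3 h2 (hperm _ _ _ (by tauto))
      · exact key c a b h3 h1 (hperm _ _ _ (by tauto))
      · exact key b a c h1 h3 (hperm _ _ _ (by tauto))
      · exact key b c a h2 h3 (hperm _ _ _ (by tauto))
      · omega
      · exact key c b a h2 h1 (hperm _ _ _ (by tauto))

theorem iteratedDeriv_two_riemannXi : iteratedDeriv 2 riemannXi (1 / 2) = -jensenCoeff 1 := by
  simp only [jensenCoeff, xiTaylorCoeff]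
  norm_num
  ring

/-- The chain rule contributes `I` twice, hence the sign change from `ξ''(½) = -c_1`. -/
theorem iteratedDeriv_two_riemannXi_critical_line :
    iteratedDeriv 2 (fun x : ℝ => riemannXi (1 / 2 + Complex.I * (x : ℂ))) 0 =
      jensenCoeff 1 := by
  have hline : ∀ (f : ℂ → ℂ), Differentiable ℂ f → ∀ x : ℝ,
      HasDerivAt (fun x : ℝ => f (1 / 2 + Complex.I * (x : ℂ)))
        (deriv f (1 / 2 + Complex.I * (x : ℂ)) * Complex.I) x := by
    intro f hf x
    have h1 : HasDerivAt (fun z : ℂ => 1 / 2 + Complex.I * z) Complex.I (x : ℂ) := by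
      simpa using ((hasDerivAt_id (x : ℂ)).const_mul Complex.I).const_add (1 / 2)
    exact ((hf _).hasDerivAt.comp (x : ℂ) h1).comp_ofReal
  have h1 : deriv (fun x : ℝ => riemannXi (1 / 2 + Complex.I * (x : ℂ))) =
      fun x : ℝ => deriv riemannXi (1 / 2 + Complex.I * (x : ℂ)) * Complex.I :=
    funext fun x => (hline _ differentiable_riemannXi x).deriv
  rw [iteratedDeriv_succ, iteratedDeriv_one, h1,
    ((hline _ differentiable_riemannXi.deriv 0).mul_const Complex.I).deriv]
  have h2 := iteratedDeriv_two_riemannXi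
  rw [iteratedDeriv_succ, iteratedDeriv_one] at h2
  rw [mul_assoc, Complex.I_mul_I, Complex.ofReal_zero, mul_zero, add_zero, h2]
  ring

theorem mainTheorem8 (hRH : RiemannHypothesis) :
    -- the coefficients `c_n` are those of the expansion of `2 ξ(½ + i x)`
    (∀ x : ℂ, HasSum (fun n : ℕ => jensenCoeff n * x ^ (2 * n) / (n.factorial : ℂ))
      (2 * riemannXi (1 / 2 + Complex.I * x))) ∧
    jensenCoeff 0 =
      -(Complex.Gamma (1 / 4) * riemannZeta (1 / 2)) / (4 * (Real.pi : ℂ) ^ (1 / 4 : ℂ)) ∧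
    -- the zeros in the upper half-plane form an infinite sequence
    (∃ s : ℕ → ℂ, EnumeratesUpperZeros s) ∧
    ∀ (s : ℕ → ℂ), EnumeratesUpperZeros s → ∀ (t : ℕ → ℝ), (∀ r, t r = (s r).im) →
      -- the product formula
      (∀ x : ℂ, Multipliable (fun r : ℕ => 1 - x ^ 2 / (t r : ℂ) ^ 2) ∧
        2 * riemannXi (1 / 2 + Complex.I * x) =
          jensenCoeff 0 * ∏' r : ℕ, (1 - x ^ 2 / (t r : ℂ) ^ 2)) ∧
      -- `c_1`
      (Summable (fun r : ℕ => 1 / t r ^ 2) ∧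
        jensenCoeff 1 = -jensenCoeff 0 * ((∑' r : ℕ, 1 / t r ^ 2 : ℝ) : ℂ)) ∧
      -- `c_2`
      (Summable (fun p : {p : ℕ × ℕ // p.1 < p.2} => 1 / (t p.1.1 ^ 2 * t p.1.2 ^ 2)) ∧
        jensenCoeff 2 = 2 * jensenCoeff 0 *
          ((∑' p : {p : ℕ × ℕ // p.1 < p.2}, 1 / (t p.1.1 ^ 2 * t p.1.2 ^ 2) : ℝ) : ℂ)) ∧
      -- `c_3`
      (Summable (fun p : {p : ℕ × ℕ × ℕ // p.1 < p.2.1 ∧ p.2.1 < p.2.2} =>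
          1 / (t p.1.1 ^ 2 * t p.1.2.1 ^ 2 * t p.1.2.2 ^ 2)) ∧
        jensenCoeff 3 = -6 * jensenCoeff 0 *
          ((∑' p : {p : ℕ × ℕ × ℕ // p.1 < p.2.1 ∧ p.2.1 < p.2.2},
            1 / (t p.1.1 ^ 2 * t p.1.2.1 ^ 2 * t p.1.2.2 ^ 2) : ℝ) : ℂ)) ∧
      -- `c_l` for every `l`: the sum runs over the sets of `l` distinct indices
      (∀ l : ℕ, Summable (fun S : {S : Finset ℕ // S.card = l} => ∏ r ∈ S.1, 1 / t r ^ 2) ∧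
        jensenCoeff l = (-1) ^ l * (l.factorial : ℂ) * jensenCoeff 0 *
          ((∑' S : {S : Finset ℕ // S.card = l}, ∏ r ∈ S.1, 1 / t r ^ 2 : ℝ) : ℂ)) ∧
      -- the second derivative, along the critical line and in the variable of `ξ`
      (iteratedDeriv 2 (fun x : ℝ => riemannXi (1 / 2 + Complex.I * (x : ℂ))) 0 =
          -jensenCoeff 0 * ((∑' r : ℕ, 1 / t r ^ 2 : ℝ) : ℂ)) ∧
      iteratedDeriv 2 riemannXi (1 / 2) =
        jensenCoeff 0 * ((∑' r : ℕ, 1 / t r ^ 2 : ℝ) : ℂ) := by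
  refine ⟨hasSum_jensenCoeff, jensenCoeff_zero_eq, exists_enumeratesUpperZeros hRH, ?_⟩
  intro s hs t ht
  have ht0 : ∀ r, 0 < t r := fun r => by
    rw [ht]
    exact hs.im_pos r
  obtain ⟨hsum, hprod⟩ := summable_and_xiSquare_eq_tprod hRH hs.im_pos hs.re_pos hs.re_lt_one
    hs.encard_eq
  simp only [← ht] at hsum hprod
  have ha : ∀ r, 0 ≤ 1 / t r ^ 2 := fun r => by positivity
  have hcoeff := jensenCoeff_eq_esymm ha hsum fun w => by
    rw [hprod w]
    congr 1
    refine tprod_congr fun r => ?_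
    push_cast
    rw [mul_one_div]
  have hcard := summable_prod_subtype_card ha hsum
  have hc1 : jensenCoeff 1 = -jensenCoeff 0 * ((∑' r : ℕ, 1 / t r ^ 2 : ℝ) : ℂ) := by
    have hsingle : ∀ r, ∏ i ∈ (singletonEquiv r).1, 1 / t i ^ 2 = 1 / t r ^ 2 := fun r =>
      Finset.prod_singleton _ _
    rw [hcoeff 1, ← singletonEquiv.tsum_eq, tsum_congr hsingle]
    simp
  have hpair : ∀ p : {p : ℕ × ℕ // p.1 < p.2}, ∏ r ∈ (ltPairEquiv p).1, 1 / t r ^ 2 =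
      1 / (t p.1.1 ^ 2 * t p.1.2 ^ 2) := by
    intro p
    change ∏ r ∈ ({p.1.1, p.1.2} : Finset ℕ), 1 / t r ^ 2 = _
    rw [Finset.prod_pair p.2.ne, one_div_mul_one_div]
  have htriple : ∀ p : {p : ℕ × ℕ × ℕ // p.1 < p.2.1 ∧ p.2.1 < p.2.2},
      ∏ r ∈ (ltTripleEquiv p).1, 1 / t r ^ 2 =
        1 / (t p.1.1 ^ 2 * t p.1.2.1 ^ 2 * t p.1.2.2 ^ 2) := by
    intro p
    change ∏ r ∈ ({p.1.1, p.1.2.1, p.1.2.2} : Finset ℕ), 1 / t r ^ 2 = _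
    rw [Finset.prod_insert, Finset.prod_pair p.2.2.ne, one_div_mul_one_div, one_div_mul_one_div,
      mul_assoc]
    simp [p.2.1.ne, (p.2.1.trans p.2.2).ne]
  refine ⟨fun x => ⟨?_, ?_⟩, ⟨hsum, hc1⟩, ⟨?_, ?_⟩, ⟨?_, ?_⟩, fun l => ⟨hcard l, hcoeff l⟩, ?_, ?_⟩
  · have h : Summable fun r => ‖-(x ^ 2 / (t r : ℂ) ^ 2)‖ := by
      refine (hsum.mul_left (‖x‖ ^ 2)).congr fun r => ?_
      rw [norm_neg, norm_div, norm_pow, norm_pow, Complex.norm_real,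
        Real.norm_of_nonneg (ht0 r).le]
      ring
    simpa [sub_eq_add_neg] using multipliable_one_add_of_summable h
  · rw [← xiSquare_sq, hprod]
    simp
  · exact (ltPairEquiv.summable_iff.mpr (hcard 2)).congr hpair
  · rw [hcoeff 2, ← ltPairEquiv.tsum_eq, tsum_congr hpair]
    simp
  · exact (ltTripleEquiv.summable_iff.mpr (hcard 3)).congr htriple
  · rw [hcoeff 3, ← ltTripleEquiv.tsum_eq, tsum_congr htriple]
    norm_num [Nat.factorial]
  · rw [iteratedDeriv_two_riemannXi_critical_line, hc1]
  · rw [iteratedDeriv_two_riemannXi, hc1]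
    ring
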